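/- A probabilistic pushdown automaton (pPDA) $\Delta=(Q,\Gamma,\delta)$ consists of a finite set $Q$ of states, a finite stack alphabet $\Gamma$, and a finite set $\delta$ of transitions $pZ \xrightarrow{a} q\alpha$ with $p,q\in Q$, $Z\in\Gamma$, rational weight $a\ge 0$ and $\alpha\in\Gamma^*$, $|\alpha|\le 2$, such that for every $pZ\in Q\times\Gamma$ the weights of the transitions leaving $pZ$ sum to $1$. It induces a transition system on the configurations $Q\times\Gamma^*$: from $pZ\beta$ it moves to $q\alpha\beta$ with the total weight of the transitions from $pZ$ to $q\alpha$; configurations $q\varepsilon$ with empty stack have no successors. Write $\mathit{ert}(pZ)\in[0,\infty]$ for the expected number of steps from $pZ$ until the stack is empty ($\infty$ if the stack is emptied with probability less than $1$), $[pZq]$ for the sum of the probabilities of all finite paths from $pZ$ to $q\varepsilon$ (the return probability), and $\mathsf E[pZq]$ for the sum, over the same paths, of probability times length (number of steps). The automaton is positively almost-surely terminating (PAST) if from every configuration the expected number of steps until the stack is empty is finite. The encoding size of $\Delta$ is $|Q|+|\Gamma|$ plus the length of the list of all its transitions, where every occurrence of a state or of a stack symbol has length one and the weights are written as pairs of integers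 in binary. **Theorem.** There exist a family $\{\Delta_n \mid n\ge 1\}$ of PAST pPDA with distinguished initial configurations $pY$ (a state $p$ and a stack symbol $Y$ of $\Delta_n$) and a constant $c>0$ such that for every $n\ge 1$: $$\mathit{ert}(pY) \;=\; \mathsf E[pYp] \;\ge\; 2^{2^n},$$ and the minimal non-zero return probability $\min\{[qZt] \mid q,t\in Q,\ Z\in\Gamma,\ [qZt]>0\}$ of $\Delta_n$ is at least $c$. Moreover, the encoding size of $\Delta_n$ is linear in $n$ (bounded above and below by positive constant multiples of $n$). -/

import Mathlib

open scoped ENNReal NNReal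

noncomputable section

/-! ### Weighted transition systems with a set of target states -/

section Systems

variable {S : Type}

/-- The matrix `M` with all rows indexed by the target set `F` replaced by zero rows. -/
def killRows (M : S → S → ℝ≥0∞) (F : Set S) (s t : S) : ℝ≥0∞ :=
  open Classical in if s ∈ F then 0 else M s t

/-- The product of the (possibly infinite) nonnegative matrix `A` and the column vector `v`. -/
def matVec (A : S → S → ℝ≥0∞) (v : S → ℝ≥0∞) (s : S) : ℝ≥0∞ :=
  ∑' t, A s t * v t

/-- The vector `1 - χ(F)`. -/
def offTarget (F : Set S) (s : S) : ℝ≥0∞ :=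
  open Classical in if s ∈ F then 0 else 1

/-- The expected runtime `∑ₖ (M_F ^ k (1 - χ(F))) s` until `F` is reached from `s`. -/
def expectedRuntime (M : S → S → ℝ≥0∞) (F : Set S) (s : S) : ℝ≥0∞ :=
  ∑' k : ℕ, ((matVec (killRows M F))^[k] (offTarget F)) s

/-- The weight of a path, given as the list of the states it visits: the product of the weights of
its steps. -/
def pathWeight (M : S → S → ℝ≥0∞) : List S → ℝ≥0∞
  | [] => 1
  | [_] => 1
  | s :: t :: π => M s t * pathWeight M (t :: π)

/-- `π` is a nonempty finite path that starts in `s`, ends in a state of `F`, and visits `F` only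
at its last position. -/
def IsProperPath (s : S) (F : Set S) (π : List S) : Prop :=
  π.head? = some s ∧ (∃ f ∈ F, π.getLast? = some f) ∧ ∀ x ∈ π.dropLast, x ∉ F

/-- The `k`-th termination moment: the sum over all proper paths `π` from `s` to `F` of the weight
of `π` times the `k`-th power of its number of steps (with `0 ^ 0 = 1`). -/
def terminationMoment (M : S → S → ℝ≥0∞) (k : ℕ) (s : S) (F : Set S) : ℝ≥0∞ :=
  ∑' π : {π : List S // IsProperPath s F π},
    pathWeight M π.1 * (((π.1.length - 1 : ℕ) : ℝ≥0∞) ^ k)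

end Systems

/-! ### Weighted and probabilistic pushdown automata -/

/-- A transition: in control state `src` with `top` on top of the stack, replace `top` by the word
`push` (whose first letter becomes the new top) and move to `tgt`, with the given rational
weight. -/
structure PDATransition (Q Γ : Type) where
  src : Q
  top : Γ
  weight : ℚ≥0
  tgt : Q
  push : List Γ

/-- Weighted pushdown automata with (finite) state set `Q` and (finite) stack alphabet `Γ`: a finite
set of weighted transitions, each of which pushes at most two symbols. -/
structure WeightedPDA (Q Γ : Type) where
  trans : Finset (PDATransition Q Γ)
  push_length : ∀ t ∈ trans, t.push.length ≤ 2

namespace WeightedPDA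

variable {Q Γ : Type} (Δ : WeightedPDA Q Γ)

open Classical in
/-- The automaton is probabilistic: for every state `p` and stack symbol `Z` the weights of the
transitions that leave `pZ` sum up to one. -/
def IsProbabilistic : Prop :=
  ∀ (p : Q) (Z : Γ), ∑ t ∈ Δ.trans with t.src = p ∧ t.top = Z, t.weight = 1

open Classical in
/-- The transition matrix on configurations (a control state and the stack content, top of the
stack first): the entry at `(pZβ, qαβ)` is the total weight of the transitions from `pZ` to `qα`.
Rows of configurations with an empty stack are zero. -/
def step : Q × List Γ → Q × List Γ → ℝ≥0∞
  | (_, []), _ => 0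
  | (p, Z :: β), d =>
      ∑ t ∈ Δ.trans with t.src = p ∧ t.top = Z ∧ (t.tgt, t.push ++ β) = d,
        ((t.weight : ℝ≥0) : ℝ≥0∞)

/-- The configurations with an empty stack. -/
def emptyStack (Q Γ : Type) : Set (Q × List Γ) := {c | c.2 = []}

/-- The expected runtime until the stack is empty, from an arbitrary configuration. -/
def ertConfig (c : Q × List Γ) : ℝ≥0∞ := expectedRuntime Δ.step (emptyStack Q Γ) c

/-- The expected runtime from the initial configuration `pZ`. -/
def ert (p : Q) (Z : Γ) : ℝ≥0∞ := Δ.ertConfig (p, [Z])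

/-- The `k`-th termination moment from `pZ` to the configuration `q` with empty stack. -/
def moment (k : ℕ) (p : Q) (Z : Γ) (q : Q) : ℝ≥0∞ :=
  terminationMoment Δ.step k (p, [Z]) {(q, [])}

/-- The return probability `[pZq]`: the zeroth termination moment. -/
def returnProb (p : Q) (Z : Γ) (q : Q) : ℝ≥0∞ := Δ.moment 0 p Z q

/-- The first termination moment from `pZ` to `q`. -/
def firstMoment (p : Q) (Z : Γ) (q : Q) : ℝ≥0∞ := Δ.moment 1 p Z q

/-- Positive almost-sure termination: from every configuration the expected runtime is finite. -/
def IsPAST : Prop := ∀ c : Q × List Γ, Δ.ertConfig c < ∞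

/-- The minimal nonzero return probability of the automaton. -/
def minReturnProb : ℝ≥0∞ :=
  sInf {x | x ≠ 0 ∧ ∃ (p : Q) (Z : Γ) (q : Q), Δ.returnProb p Z q = x}

/-- The encoding size: the number of states, plus the number of stack symbols, plus the length of
the list of all transitions, where each occurrence of a state or of a stack symbol has length one
and the weight is written as a pair of integers in binary. -/
def encodingSize [Fintype Q] [Fintype Γ] : ℕ :=
  Fintype.card Q + Fintype.card Γ +
    ∑ t ∈ Δ.trans, (3 + t.push.length + t.weight.num.size + t.weight.den.size)

end WeightedPDA

end

/-! A bit symbol of level `i` unfolds into `2 ^ i` independent bits, each equal to one with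
probability 1/4, and adds their parity to the state. Since the bias (even minus odd probability)
multiplies under independent sums, it is `(1/2) ^ 2 ^ i` (`parityProb_bias`), although both parities
have probability at least 1/4. Linearly many symbols thus produce a coin that is fair up to a doubly
exponentially small error.

Such a coin of level `n` drives a random walk on the number of generators: even parity removes one
generator, odd parity adds one. The drift is `-(1/2) ^ 2 ^ n`, so the walk started at one needs at
least `2 ^ 2 ^ n` rounds on average, while every nonzero return probability stays bounded away from
zero.

An explicit finite solution of the runtime equations gives PAST (`ertConfig_parityPDA_le`). The
lower bound comes from the gambler's ruin recurrence (`one_le_mul_of_recurrence`). A generator at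
the bottom of the stack can only be emptied into the state `false` (`guardedConfigs`), so the
runtime equals the first moment (`expectedRuntime_eq_terminationMoment`). -/

section Systems

variable {S : Type}

/-! ### Matrix-vector calculus and expected runtimes -/

theorem matVec_congr {A : S → S → ℝ≥0∞} {u v : S → ℝ≥0∞} {s : S}
    (h : ∀ t, A s t ≠ 0 → u t = v t) : matVec A u s = matVec A v s := by
  refine tsum_congr fun t => ?_
  by_cases h0 : A s t = 0
  · simp [h0]
  · rw [h t h0]

theorem matVec_mono {A : S → S → ℝ≥0∞} {u v : S → ℝ≥0∞} (h : u ≤ v) :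
    matVec A u ≤ matVec A v :=
  fun _ => ENNReal.tsum_le_tsum fun t => mul_le_mul_right (h t) _

theorem matVec_add (A : S → S → ℝ≥0∞) (u v : S → ℝ≥0∞) (s : S) :
    matVec A (fun t => u t + v t) s = matVec A u s + matVec A v s := by
  simp only [matVec, mul_add, ENNReal.tsum_add]

theorem matVec_sum {ι : Type} (A : S → S → ℝ≥0∞) (I : Finset ι) (u : ι → S → ℝ≥0∞) (s : S) :
    matVec A (fun t => ∑ k ∈ I, u k t) s = ∑ k ∈ I, matVec A (u k) s := by
  simp only [matVec, Finset.mul_sum]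
  exact Summable.tsum_finsetSum fun _ _ => ENNReal.summable

theorem matVec_tsum {ι : Type} (A : S → S → ℝ≥0∞) (u : ι → S → ℝ≥0∞) (s : S) :
    matVec A (fun t => ∑' k, u k t) s = ∑' k, matVec A (u k) s := by
  simp only [matVec, ← ENNReal.tsum_mul_left]
  exact ENNReal.tsum_comm

theorem killRows_of_mem (M : S → S → ℝ≥0∞) {F : Set S} {s : S} (h : s ∈ F) (t : S) :
    killRows M F s t = 0 := by
  simp [killRows, h]

theorem killRows_of_notMem (M : S → S → ℝ≥0∞) {F : Set S} {s : S} (h : s ∉ F) (t : S) :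
    killRows M F s t = M s t := by
  simp [killRows, h]

theorem matVec_killRows_of_mem (M : S → S → ℝ≥0∞) {F : Set S} {s : S} (h : s ∈ F)
    (v : S → ℝ≥0∞) : matVec (killRows M F) v s = 0 := by
  simp [matVec, killRows_of_mem M h]

theorem matVec_killRows_of_notMem (M : S → S → ℝ≥0∞) {F : Set S} {s : S} (h : s ∉ F)
    (v : S → ℝ≥0∞) : matVec (killRows M F) v s = matVec M v s := by
  simp [matVec, killRows_of_notMem M h]

theorem tsum_iterate_matVec (A : S → S → ℝ≥0∞) (v : S → ℝ≥0∞) (s : S) :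
    ∑' k : ℕ, (matVec A)^[k] v s
      = v s + matVec A (fun t => ∑' k : ℕ, (matVec A)^[k] v t) s := by
  rw [tsum_eq_zero_add' ENNReal.summable, matVec_tsum]
  simp only [Function.iterate_succ_apply', Function.iterate_zero, id]

theorem sum_range_succ_iterate_matVec (A : S → S → ℝ≥0∞) (v : S → ℝ≥0∞) (K : ℕ) (s : S) :
    ∑ k ∈ Finset.range (K + 1), (matVec A)^[k] v s
      = v s + matVec A (fun t => ∑ k ∈ Finset.range K, (matVec A)^[k] v t) s := by
  rw [Finset.sum_range_succ', matVec_sum, add_comm]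
  simp only [Function.iterate_succ_apply', Function.iterate_zero, id]

/-- The expected runtime is below every solution of the inequation `1 - χ(F) + M_F g ≤ g`. -/
theorem expectedRuntime_le {M : S → S → ℝ≥0∞} {F : Set S} {g : S → ℝ≥0∞}
    (h : ∀ s, offTarget F s + matVec (killRows M F) g s ≤ g s) (s : S) :
    expectedRuntime M F s ≤ g s := by
  rw [expectedRuntime, ENNReal.tsum_eq_iSup_nat]
  refine iSup_le fun K => ?_
  induction K generalizing s with
  | zero => simp
  | succ K ih =>
    rw [sum_range_succ_iterate_matVec]
    exact (add_le_add le_rfl (matVec_mono ih s)).trans (h s)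

theorem expectedRuntime_of_mem {M : S → S → ℝ≥0∞} {F : Set S} {s : S} (h : s ∈ F) :
    expectedRuntime M F s = 0 := by
  rw [expectedRuntime, tsum_iterate_matVec, matVec_killRows_of_mem M h]
  simp [offTarget, h]

theorem expectedRuntime_of_notMem {M : S → S → ℝ≥0∞} {F : Set S} {s : S} (h : s ∉ F) :
    expectedRuntime M F s = 1 + matVec M (expectedRuntime M F) s := by
  conv_lhs => rw [expectedRuntime, tsum_iterate_matVec, matVec_killRows_of_notMem M h]
  simp only [offTarget, h, if_false]
  rfl

/-! ### Hitting weights and termination moments -/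

/-- The indicator vector of the target set. -/
noncomputable def onTarget (F : Set S) (s : S) : ℝ≥0∞ :=
  open Classical in if s ∈ F then 1 else 0

/-- The total weight of the proper paths from `s` to `F` with exactly `k` steps. -/
noncomputable def hitWeight (M : S → S → ℝ≥0∞) (F : Set S) (k : ℕ) : S → ℝ≥0∞ :=
  (matVec (killRows M F))^[k] (onTarget F)

theorem hitWeight_zero (M : S → S → ℝ≥0∞) (F : Set S) : hitWeight M F 0 = onTarget F := rfl

theorem hitWeight_succ (M : S → S → ℝ≥0∞) (F : Set S) (k : ℕ) :
    hitWeight M F (k + 1) = matVec (killRows M F) (hitWeight M F k) :=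
  Function.iterate_succ_apply' _ _ _

theorem tsum_list (f : List S → ℝ≥0∞) :
    ∑' l, f l = f [] + ∑' a : S, ∑' l : List S, f (a :: l) := by
  let e : Unit ⊕ S × List S ≃ List S :=
    { toFun := Sum.elim (fun _ => []) fun x => x.1 :: x.2
      invFun := fun l => match l with
        | [] => Sum.inl ()
        | a :: l => Sum.inr (a, l)
      left_inv := by rintro (_ | ⟨a, l⟩) <;> rfl
      right_inv := by rintro (_ | ⟨a, l⟩) <;> rfl }
  rw [← e.tsum_eq, Summable.tsum_sum ENNReal.summable ENNReal.summable, ← ENNReal.tsum_prod]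
  simp [e]

theorem isProperPath_singleton (s : S) (F : Set S) : IsProperPath s F [s] ↔ s ∈ F := by
  simp [IsProperPath]

theorem isProperPath_cons_cons (s t : S) (F : Set S) (π : List S) :
    IsProperPath s F (s :: t :: π) ↔ s ∉ F ∧ IsProperPath t F (t :: π) := by
  simp only [IsProperPath, List.head?_cons, List.getLast?_cons_cons, List.dropLast_cons_cons,
    List.forall_mem_cons, true_and]
  tauto

-- Links the path-based moments to powers of the matrix: splitting off the first step of a path is
-- one multiplication by `killRows M F`.
open Classical in
theorem tsum_isProperPath_cons (M : S → S → ℝ≥0∞) (F : Set S) (k : ℕ) (s : S) :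
    ∑' l : List S, (if IsProperPath s F (s :: l) ∧ l.length = k then pathWeight M (s :: l) else 0)
      = hitWeight M F k s := by
  induction k generalizing s with
  | zero =>
    rw [tsum_eq_single []]
    · simp [isProperPath_singleton, pathWeight, hitWeight_zero, onTarget]
    · intro l hl
      simp [hl]
  | succ k ih =>
    rw [tsum_list, hitWeight_succ]
    simp only [List.length_nil, List.length_cons, isProperPath_cons_cons, pathWeight]
    by_cases hs : s ∈ F
    · simp [hs, matVec_killRows_of_mem]
    · rw [matVec_killRows_of_notMem M hs, matVec]
      simp only [hs, ← ih, ← ENNReal.tsum_mul_left]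
      simp

theorem terminationMoment_eq_tsum (M : S → S → ℝ≥0∞) (k : ℕ) (s : S) (F : Set S) :
    terminationMoment M k s F = ∑' j : ℕ, hitWeight M F j s * (j : ℝ≥0∞) ^ k := by
  classical
  have hhead : ∀ a l, IsProperPath s F (a :: l) → a = s := by
    rintro a l ⟨h, -⟩
    simpa using h
  have h1 : terminationMoment M k s F
      = ∑' l : List S, if IsProperPath s F (s :: l) then
          pathWeight M (s :: l) * (l.length : ℝ≥0∞) ^ k else 0 := by
    rw [terminationMoment]
    refine (tsum_subtype {π : List S | IsProperPath s F π}
      (fun π => pathWeight M π * (((π.length - 1 : ℕ) : ℝ≥0∞) ^ k))).trans ?_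
    rw [tsum_list, tsum_eq_single s, Set.indicator_of_notMem (by simp [IsProperPath]), zero_add]
    · simp [Set.indicator]
    · intro a ha
      refine ENNReal.tsum_eq_zero.2 fun l => ?_
      have hnot : a :: l ∉ {π | IsProperPath s F π} := fun h => ha (hhead a l h)
      rw [Set.indicator_of_notMem hnot]
  rw [h1]
  simp only [← tsum_isProperPath_cons, ← ENNReal.tsum_mul_right]
  rw [ENNReal.tsum_comm]
  refine tsum_congr fun l => ?_
  rw [tsum_eq_single l.length]
  · split_ifs <;> simp_all
  · intro j hj
    simp [Ne.symm hj]

theorem terminationMoment_zero_of_mem {M : S → S → ℝ≥0∞} {s : S} {F : Set S} (h : s ∈ F) :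
    terminationMoment M 0 s F = 1 := by
  simp only [terminationMoment_eq_tsum, pow_zero, mul_one, hitWeight]
  rw [tsum_iterate_matVec, matVec_killRows_of_mem M h]
  simp [onTarget, h]

theorem terminationMoment_zero_of_notMem {M : S → S → ℝ≥0∞} {s : S} {F : Set S} (h : s ∉ F) :
    terminationMoment M 0 s F = matVec M (fun t => terminationMoment M 0 t F) s := by
  simp only [terminationMoment_eq_tsum, pow_zero, mul_one, hitWeight]
  conv_lhs => rw [tsum_iterate_matVec, matVec_killRows_of_notMem M h]
  simp [onTarget, h]

/-- The target is not reached from a set of states that avoids it and is closed under `M`. -/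
theorem terminationMoment_eq_zero {M : S → S → ℝ≥0∞} {F G : Set S}
    (hGF : ∀ s ∈ G, s ∉ F) (hG : ∀ s ∈ G, ∀ t, M s t ≠ 0 → t ∈ G) (k : ℕ) {s : S} (hs : s ∈ G) :
    terminationMoment M k s F = 0 := by
  have h : ∀ j, ∀ s ∈ G, hitWeight M F j s = 0 := by
    intro j
    induction j with
    | zero =>
      intro s hs
      simp [hitWeight_zero, onTarget, hGF s hs]
    | succ j ih =>
      intro s hs
      rw [hitWeight_succ, matVec_killRows_of_notMem M (hGF s hs),
        matVec_congr (v := fun _ => 0) fun t ht => ih t (hG s hs t ht)]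
      simp [matVec]
  simp [terminationMoment_eq_tsum, h _ s hs]

/-- In a set of states on which `M` is stochastic off `F'`, and in which `F'` can only be entered
through `F`, a finite expected runtime equals the first termination moment. -/
theorem expectedRuntime_eq_terminationMoment {M : S → S → ℝ≥0∞} {F F' G : Set S}
    (hF : ∀ s ∈ G, (s ∈ F ↔ s ∈ F')) (hG : ∀ s ∈ G, s ∉ F' → ∀ t, M s t ≠ 0 → t ∈ G)
    (hM : ∀ s ∈ G, s ∉ F' → ∑' t, M s t = 1) {s : S} (hs : s ∈ G)
    (hfin : expectedRuntime M F' s ≠ ∞) :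
    expectedRuntime M F' s = terminationMoment M 1 s F := by
  set e : ℕ → S → ℝ≥0∞ := fun k => (matVec (killRows M F'))^[k] (offTarget F') with he
  -- Here `e K s` is the probability of not having reached `F'` after `K` steps; it complements the
  -- probability of a hit within `K` steps.
  have hsum : ∀ K, ∀ s ∈ G, ∑ k ∈ Finset.range (K + 1), hitWeight M F k s + e K s = 1 := by
    intro K
    induction K with
    | zero =>
      intro s hs
      by_cases h : s ∈ F' <;> simp [he, hitWeight_zero, onTarget, offTarget, hF s hs, h]
    | succ K ih =>
      intro s hs
      have hsucc : e (K + 1) = matVec (killRows M F') (e K) :=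
        Function.iterate_succ_apply' _ _ _
      simp only [hitWeight, sum_range_succ_iterate_matVec _ _ (K + 1), hsucc]
      by_cases h : s ∈ F'
      · rw [matVec_killRows_of_mem M h, matVec_killRows_of_mem M ((hF s hs).2 h)]
        simp [onTarget, hF s hs, h]
      · have h' : s ∉ F := fun hsF => h ((hF s hs).1 hsF)
        rw [matVec_killRows_of_notMem M h, matVec_killRows_of_notMem M h', add_assoc, ← matVec_add]
        change _ + matVec M (fun t => ∑ k ∈ Finset.range (K + 1), hitWeight M F k t + e K t) s = 1
        rw [matVec_congr (v := fun _ => 1) (by exact fun t ht => ih t (hG s hs h t ht))]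
        simp [onTarget, h', matVec, hM s hs h]
  have hlim : Filter.Tendsto (fun K => e K s) Filter.atTop (nhds 0) :=
    ENNReal.tendsto_atTop_zero_of_tsum_ne_top hfin
  -- A finite runtime is a convergent sum of the `e K s`, so these tend to zero and the target is
  -- hit almost surely.
  have hone : ∑' k, hitWeight M F k s = 1 := by
    have h1 : Filter.Tendsto (fun K => ∑ k ∈ Finset.range (K + 1), hitWeight M F k s + e K s)
        Filter.atTop (nhds (∑' k, hitWeight M F k s + 0)) :=
      ((ENNReal.tendsto_nat_tsum _).comp (Filter.tendsto_add_atTop_nat 1)).add hlim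
    simp only [hsum _ s hs, add_zero] at h1
    exact tendsto_nhds_unique h1 tendsto_const_nhds
  have htail : ∀ K, e K s = ∑' j, if K < j then hitWeight M F j s else 0 := by
    intro K
    have hsplit : ∑' j, hitWeight M F j s = ∑ j ∈ Finset.range (K + 1), hitWeight M F j s
        + ∑' j, if K < j then hitWeight M F j s else 0 := by
      have hhead : ∑ j ∈ Finset.range (K + 1), hitWeight M F j s
          = ∑' j, if j ≤ K then hitWeight M F j s else 0 := by
        rw [tsum_eq_sum (s := Finset.range (K + 1)) (by simp; omega)]
        exact Finset.sum_congr rfl fun j hj =>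
          (if_pos (Nat.lt_succ_iff.1 (Finset.mem_range.1 hj))).symm
      rw [hhead, ← ENNReal.tsum_add]
      refine tsum_congr fun j => ?_
      by_cases h : K < j
      · simp [h, not_le.2 h]
      · simp [h, not_lt.1 h]
    -- Cancellation in `ℝ≥0∞` requires the partial sum to be finite.
    have hne : ∑ j ∈ Finset.range (K + 1), hitWeight M F j s ≠ ∞ := by
      intro htop
      have := hsum K s hs
      simp [htop] at this
    rw [hone, ← hsum K s hs] at hsplit
    exact (ENNReal.add_right_inj hne).1 hsplit
  calc expectedRuntime M F' s = ∑' K, e K s := rfl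
    _ = ∑' j, ∑' K, if K < j then hitWeight M F j s else 0 := by
      simp only [htail]
      exact ENNReal.tsum_comm
    _ = terminationMoment M 1 s F := by
      rw [terminationMoment_eq_tsum]
      refine tsum_congr fun j => ?_
      rw [tsum_eq_sum (s := Finset.range j)]
      · rw [Finset.sum_congr rfl fun K hK => if_pos (Finset.mem_range.1 hK)]
        simp [mul_comm]
      · intro K hK
        exact if_neg fun h => hK (Finset.mem_range.2 h)

end Systems

/-! ### One-step equations of pushdown automata -/

namespace WeightedPDA

variable {Q Γ : Type} (Δ : WeightedPDA Q Γ)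

open Classical in
theorem matVec_step_cons (v : Q × List Γ → ℝ≥0∞) (p : Q) (Z : Γ) (β : List Γ) :
    matVec Δ.step v (p, Z :: β)
      = ∑ t ∈ Δ.trans with t.src = p ∧ t.top = Z,
          ((t.weight : ℝ≥0) : ℝ≥0∞) * v (t.tgt, t.push ++ β) := by
  have h : ∀ d, Δ.step (p, Z :: β) d * v d = ∑ t ∈ Δ.trans with t.src = p ∧ t.top = Z,
      if d = (t.tgt, t.push ++ β) then ((t.weight : ℝ≥0) : ℝ≥0∞) * v d else 0 := by
    intro d
    simp only [step, Finset.sum_mul, ← and_assoc]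
    rw [← Finset.filter_filter, Finset.sum_filter]
    exact Finset.sum_congr rfl fun t _ => by simp only [eq_comm]
  simp only [matVec, h]
  rw [Summable.tsum_finsetSum fun _ _ => ENNReal.summable]
  exact Finset.sum_congr rfl fun t _ => tsum_ite_eq _ _

open Classical in
theorem tsum_step_cons (hΔ : Δ.IsProbabilistic) (p : Q) (Z : Γ) (β : List Γ) :
    ∑' d, Δ.step (p, Z :: β) d = 1 := by
  have h := Δ.matVec_step_cons (fun _ => 1) p Z β
  simp only [matVec, mul_one] at h
  rw [h, ← ENNReal.ofNNReal_finsetSum]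
  have := congrArg (fun x : ℚ≥0 => (x : ℝ≥0)) (hΔ p Z)
  simp only [NNRat.cast_sum, NNRat.cast_one] at this
  rw [this, ENNReal.coe_one]

/-- A one-step successor of a configuration arises from a transition of the automaton. -/
theorem exists_trans_of_step_ne_zero {p : Q} {Z : Γ} {β : List Γ} {d : Q × List Γ}
    (h : Δ.step (p, Z :: β) d ≠ 0) :
    ∃ t ∈ Δ.trans, t.src = p ∧ t.top = Z ∧ d = (t.tgt, t.push ++ β) := by
  classical
  obtain ⟨t, ht, -⟩ := Finset.exists_ne_zero_of_sum_ne_zero h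
  simp only [Finset.mem_filter] at ht
  exact ⟨t, ht.1, ht.2.1, ht.2.2.1, ht.2.2.2.symm⟩

theorem ertConfig_nil (p : Q) : Δ.ertConfig (p, []) = 0 :=
  expectedRuntime_of_mem rfl

theorem ertConfig_cons (p : Q) (Z : Γ) (β : List Γ) :
    Δ.ertConfig (p, Z :: β) = 1 + matVec Δ.step Δ.ertConfig (p, Z :: β) :=
  expectedRuntime_of_notMem (by simp [emptyStack])

end WeightedPDA

/-! ### The parity of biased random bits -/

/-- The probabilities that the parity of `2 ^ i` independent random bits, each of which is one with
probability `1 / 4`, is even and odd, respectively. -/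
noncomputable def parityProb : ℕ → ℝ≥0 × ℝ≥0
  | 0 => (3 / 4, 1 / 4)
  | i + 1 => ((parityProb i).1 ^ 2 + (parityProb i).2 ^ 2, 2 * (parityProb i).1 * (parityProb i).2)

theorem parityProb_sum (i : ℕ) : (parityProb i).1 + (parityProb i).2 = 1 := by
  induction i with
  | zero => simp only [parityProb]; rw [← add_div]; norm_num
  | succ i ih =>
    calc (parityProb (i + 1)).1 + (parityProb (i + 1)).2
        = ((parityProb i).1 + (parityProb i).2) ^ 2 := by simp only [parityProb]; ring
      _ = 1 := by rw [ih, one_pow]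

/-- The bias of the parity is doubly exponentially small. -/
theorem parityProb_bias (i : ℕ) :
    ((parityProb i).1 : ℝ) - (parityProb i).2 = (1 / 2) ^ 2 ^ i := by
  induction i with
  | zero => norm_num [parityProb]
  | succ i ih =>
    -- The bias squares at each level: `(a² + c²) - 2ac = (a - c)²`.
    rw [pow_succ 2 i, pow_mul, ← ih]
    simp only [parityProb]
    push_cast
    ring

theorem parityProb_sum_real (i : ℕ) : ((parityProb i).1 : ℝ) + (parityProb i).2 = 1 := by
  exact_mod_cast parityProb_sum i

theorem half_le_parityProb_fst (i : ℕ) : 1 / 2 ≤ (parityProb i).1 := by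
  have h1 := parityProb_bias i
  have h2 := parityProb_sum_real i
  have h3 : (0 : ℝ) < (1 / 2) ^ 2 ^ i := by positivity
  rw [← NNReal.coe_le_coe]
  push_cast
  linarith

/-- The next odd probability is `2ac`, and `a ≥ 1/2` gives `2ac ≥ c`, so the odd probability never
decreases. -/
theorem quarter_le_parityProb_snd (i : ℕ) : 1 / 4 ≤ (parityProb i).2 := by
  induction i with
  | zero => simp [parityProb]
  | succ i ih =>
    have h := half_le_parityProb_fst i
    rw [← NNReal.coe_le_coe] at h ih ⊢
    simp only [parityProb]
    push_cast at h ih ⊢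
    nlinarith

/-- The number of steps in which the automaton processes the bit symbol of level `i`. -/
def bitSteps : ℕ → ℕ
  | 0 => 1
  | i + 1 => 1 + 2 * bitSteps i

/-- The expected runtime of the generator symbol. -/
def generatorSteps (n : ℕ) : ℕ := (bitSteps n + 2) * 2 ^ 2 ^ n

/-- One round costs the generator step, the bits and the test, and leaves two generators with the
odd probability. The equation is solvable because `1 - 2c` is exactly the bias. -/
theorem generatorSteps_eq (n : ℕ) :
    (generatorSteps n : ℝ≥0) = bitSteps n + 2 + 2 * (parityProb n).2 * generatorSteps n := by
  have h1 := parityProb_bias n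
  have h2 := parityProb_sum_real n
  have h3 : ((1 / 2 : ℝ)) ^ 2 ^ n * 2 ^ 2 ^ n = 1 := by
    rw [← mul_pow]
    norm_num
  rw [← NNReal.coe_inj]
  simp only [generatorSteps]
  push_cast
  have h4 : 2 * ((parityProb n).2 : ℝ) = 1 - (1 / 2) ^ 2 ^ n := by linarith
  rw [h4]
  linear_combination ((bitSteps n : ℝ) + 2) * h3

/-! ### The automaton and its encoding size -/

/-- The stack symbols: bit symbols of the levels `0, …, n`, the generator `inr true`, and the test
symbol `inr false`. -/
abbrev ParitySymbol (n : ℕ) : Type := Fin (n + 1) ⊕ Bool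

open Classical in
/-- The bit symbol of level `0` is popped and flips the state with probability `1 / 4`; a bit symbol
of a higher level is replaced by two of the next lower level; the generator pushes the bit symbol of
level `n` on top of the test symbol; the test symbol is popped in the state `false`, and replaced by
two generators in the state `true`. -/
noncomputable def parityRules (n : ℕ) :
    Bool → ParitySymbol n → Finset (PDATransition Bool (ParitySymbol n))
  | s, .inl ⟨0, h⟩ =>
      {⟨s, .inl ⟨0, h⟩, 3 / 4, s, []⟩, ⟨s, .inl ⟨0, h⟩, 1 / 4, !s, []⟩}
  | s, .inl ⟨i + 1, h⟩ =>
      {⟨s, .inl ⟨i + 1, h⟩, 1, s,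
        [.inl ⟨i, Nat.lt_of_succ_lt h⟩, .inl ⟨i, Nat.lt_of_succ_lt h⟩]⟩}
  | s, .inr true => {⟨s, .inr true, 1, false, [.inl (Fin.last n), .inr false]⟩}
  | false, .inr false => {⟨false, .inr false, 1, false, []⟩}
  | true, .inr false => {⟨true, .inr false, 1, false, [.inr true, .inr true]⟩}

theorem src_top_of_mem_parityRules {n : ℕ} {s : Bool} {Z : ParitySymbol n}
    {t : PDATransition Bool (ParitySymbol n)} (h : t ∈ parityRules n s Z) :
    t.src = s ∧ t.top = Z := by
  rcases Z with ⟨_ | i, hi⟩ | _ | _ <;> rcases s with _ | _ <;>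
    simp only [parityRules, Finset.mem_insert, Finset.mem_singleton] at h <;>
    rcases h with rfl | rfl <;> exact ⟨rfl, rfl⟩

theorem push_length_of_mem_parityRules {n : ℕ} {s : Bool} {Z : ParitySymbol n}
    {t : PDATransition Bool (ParitySymbol n)} (h : t ∈ parityRules n s Z) :
    t.push.length ≤ 2 := by
  rcases Z with ⟨_ | i, hi⟩ | _ | _ <;> rcases s with _ | _ <;>
    simp only [parityRules, Finset.mem_insert, Finset.mem_singleton] at h <;>
    rcases h with rfl | rfl <;> simp

open Classical in
/-- The automaton with the transitions `parityRules`. -/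
noncomputable def parityPDA (n : ℕ) : WeightedPDA Bool (ParitySymbol n) where
  trans := (Finset.univ : Finset (Bool × ParitySymbol n)).biUnion fun x => parityRules n x.1 x.2
  push_length t ht := by
    obtain ⟨x, -, hx⟩ := Finset.mem_biUnion.1 ht
    exact push_length_of_mem_parityRules hx

theorem parityPDA_filter_trans (n : ℕ) (s : Bool) (Z : ParitySymbol n)
    [DecidablePred fun t : PDATransition Bool (ParitySymbol n) => t.src = s ∧ t.top = Z] :
    {t ∈ (parityPDA n).trans | t.src = s ∧ t.top = Z} = parityRules n s Z := by
  ext t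
  simp only [parityPDA, Finset.mem_filter, Finset.mem_biUnion, Finset.mem_univ, true_and]
  constructor
  · rintro ⟨⟨x, hx⟩, rfl, rfl⟩
    rwa [(src_top_of_mem_parityRules hx).1, (src_top_of_mem_parityRules hx).2]
  · exact fun h => ⟨⟨(s, Z), h⟩, src_top_of_mem_parityRules h⟩

theorem parityRules_zero_ne {n : ℕ} (s : Bool) (h : 0 < n + 1) :
    (⟨s, .inl ⟨0, h⟩, 3 / 4, s, []⟩ : PDATransition Bool (ParitySymbol n))
      ≠ ⟨s, .inl ⟨0, h⟩, 1 / 4, !s, []⟩ := by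
  simp

theorem parityPDA_isProbabilistic (n : ℕ) : (parityPDA n).IsProbabilistic := by
  classical
  intro s Z
  rw [parityPDA_filter_trans]
  rcases Z with ⟨_ | i, hi⟩ | _ | _ <;> rcases s with _ | _ <;> simp only [parityRules]
  all_goals first
    | exact Finset.sum_singleton _ _
    | rw [Finset.sum_pair (parityRules_zero_ne _ hi), ← add_div]; norm_num

theorem encodingSize_parityPDA (n : ℕ) :
    n ≤ (parityPDA n).encodingSize ∧ (parityPDA n).encodingSize ≤ 31 * n + 95 := by
  classical
  -- The largest contribution of one pair of state and symbol is that of a level-zero bit: 8 for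
  -- weight 3/4 plus 7 for weight 1/4.
  have hsum : ∑ t ∈ (parityPDA n).trans,
      (3 + t.push.length + t.weight.num.size + t.weight.den.size) ≤ 15 * (2 * (n + 3)) := by
    rw [parityPDA, Finset.sum_biUnion]
    · refine (Finset.sum_le_card_nsmul _ _ 15 ?_).trans_eq ?_
      · rintro ⟨s, Z⟩ -
        have h1 : Nat.size 1 = 1 := by decide
        have h3 : Nat.size 3 = 2 := by decide
        have h4 : Nat.size 4 = 3 := by decide
        have hq3 : ((3 / 4 : ℚ≥0) : ℚ) = 3 / 4 := by norm_num
        have hn3 : (3 / 4 : ℚ≥0).num = 3 := by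
          rw [NNRat.num, hq3]
          norm_num
        have hd3 : (3 / 4 : ℚ≥0).den = 4 := by
          rw [NNRat.den, hq3]
          norm_num
        have hq1 : ((1 / 4 : ℚ≥0) : ℚ) = 1 / 4 := by norm_num
        have hn1 : (1 / 4 : ℚ≥0).num = 1 := by
          rw [NNRat.num, hq1]
          norm_num
        have hd1 : (1 / 4 : ℚ≥0).den = 4 := by
          rw [NNRat.den, hq1]
          norm_num
        rcases Z with ⟨_ | i, hi⟩ | _ | _ <;> rcases s with _ | _ <;> simp only [parityRules]
        all_goals first
          | rw [Finset.sum_singleton]; simp [h1]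
          | rw [Finset.sum_pair (parityRules_zero_ne _ hi)]
            simp only [hn3, hd3, hn1, hd1, h1, h3, h4, List.length_nil]
            norm_num
      · simp
        ring
    · rintro x - y - hxy
      refine Finset.disjoint_left.2 fun t hx hy => hxy (Prod.ext ?_ ?_)
      · exact (src_top_of_mem_parityRules hx).1.symm.trans (src_top_of_mem_parityRules hy).1
      · exact (src_top_of_mem_parityRules hx).2.symm.trans (src_top_of_mem_parityRules hy).2
  simp only [WeightedPDA.encodingSize, Fintype.card_bool, Fintype.card_sum, Fintype.card_fin]
  omega

/-! ### One-step equations of the parity automaton -/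

section StepMatrix

variable {n : ℕ} (v : Bool × List (ParitySymbol n) → ℝ≥0∞) (s : Bool) (β : List (ParitySymbol n))

theorem matVec_parityPDA_zero (h : 0 < n + 1) :
    matVec (parityPDA n).step v (s, .inl ⟨0, h⟩ :: β)
      = ((parityProb 0).1 : ℝ≥0∞) * v (s, β) + ((parityProb 0).2 : ℝ≥0∞) * v (!s, β) := by
  classical
  rw [WeightedPDA.matVec_step_cons, parityPDA_filter_trans]
  simp only [parityRules]
  rw [Finset.sum_pair (parityRules_zero_ne _ h)]
  simp [parityProb]

theorem matVec_parityPDA_succ (i : ℕ) (h : i + 1 < n + 1) :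
    matVec (parityPDA n).step v (s, .inl ⟨i + 1, h⟩ :: β)
      = v (s, .inl ⟨i, Nat.lt_of_succ_lt h⟩ :: .inl ⟨i, Nat.lt_of_succ_lt h⟩ :: β) := by
  rw [WeightedPDA.matVec_step_cons, parityPDA_filter_trans]
  simp [parityRules]

theorem matVec_parityPDA_generator :
    matVec (parityPDA n).step v (s, .inr true :: β)
      = v (false, .inl (Fin.last n) :: .inr false :: β) := by
  rw [WeightedPDA.matVec_step_cons, parityPDA_filter_trans]
  simp [parityRules]

theorem matVec_parityPDA_test_false :
    matVec (parityPDA n).step v (false, .inr false :: β) = v (false, β) := by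
  rw [WeightedPDA.matVec_step_cons, parityPDA_filter_trans]
  simp [parityRules]

theorem matVec_parityPDA_test_true :
    matVec (parityPDA n).step v (true, .inr false :: β)
      = v (false, .inr true :: .inr true :: β) := by
  rw [WeightedPDA.matVec_step_cons, parityPDA_filter_trans]
  simp [parityRules]

variable {v}

/-- The effect of processing a bit symbol on a vector that accumulates the reward `κ` in each
step. -/
theorem eq_of_bit_cons {κ : ℝ≥0∞}
    (hv : ∀ p Z β, v (p, Z :: β) = κ + matVec (parityPDA n).step v (p, Z :: β))
    (i : Fin (n + 1)) :
    v (s, .inl i :: β) = bitSteps i * κ + ((parityProb i).1 : ℝ≥0∞) * v (s, β)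
      + ((parityProb i).2 : ℝ≥0∞) * v (!s, β) := by
  obtain ⟨i, hi⟩ := i
  induction i generalizing s β with
  | zero =>
    rw [hv, matVec_parityPDA_zero]
    simp [bitSteps, add_assoc]
  | succ i ih =>
    -- The second bit of level `i` costs the same from either state, so the two branches of the
    -- first bit recombine with total weight one. Used later with `κ = 1` for runtimes and `κ = 0`
    -- for return probabilities.
    have h1 : ((parityProb i).1 : ℝ≥0∞) + (parityProb i).2 = 1 := by
      exact_mod_cast parityProb_sum i
    rw [hv, matVec_parityPDA_succ, ih, ih, ih, Bool.not_not]
    simp only [parityProb, bitSteps]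
    push_cast
    calc _ = κ + bitSteps i * κ + (((parityProb i).1 : ℝ≥0∞) + (parityProb i).2) * bitSteps i * κ
          + ((((parityProb i).1 : ℝ≥0∞) ^ 2 + ((parityProb i).2 : ℝ≥0∞) ^ 2) * v (s, β)
          + 2 * ((parityProb i).1 : ℝ≥0∞) * ((parityProb i).2 : ℝ≥0∞) * v (!s, β)) := by ring
      _ = _ := by rw [h1]; ring

end StepMatrix

/-! ### Upper bound on the runtime and PAST -/

/-- The expected runtime of `parityPDA n`, as a function of the stack content and the state. -/
noncomputable def parityRuntime (n : ℕ) : List (ParitySymbol n) → Bool → ℝ≥0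
  | [], _ => 0
  | .inl i :: β, s => bitSteps i + (parityProb i).1 * parityRuntime n β s
      + (parityProb i).2 * parityRuntime n β (!s)
  | .inr true :: β, _ => generatorSteps n + parityRuntime n β false
  | .inr false :: β, false => 1 + parityRuntime n β false
  | .inr false :: β, true => 1 + 2 * generatorSteps n + parityRuntime n β false

/-- `parityRuntime` solves the one-step equations, and the expected runtime lies below every
solution. Its values are finite, which is what PAST needs. -/
theorem ertConfig_parityPDA_le (n : ℕ) (c : Bool × List (ParitySymbol n)) :
    (parityPDA n).ertConfig c ≤ parityRuntime n c.2 c.1 := by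
  refine expectedRuntime_le (g := fun c => (parityRuntime n c.2 c.1 : ℝ≥0∞)) ?_ c
  rintro ⟨s, _ | ⟨Z, β⟩⟩
  · rw [matVec_killRows_of_mem _ (by rfl)]
    simp [offTarget, WeightedPDA.emptyStack]
  · have hmem : (s, Z :: β) ∉ WeightedPDA.emptyStack Bool (ParitySymbol n) := by
      simp [WeightedPDA.emptyStack]
    rw [matVec_killRows_of_notMem _ hmem, offTarget, if_neg hmem]
    rcases Z with ⟨_ | i, hi⟩ | _ | _
    · rw [matVec_parityPDA_zero]
      simp only [parityRuntime, bitSteps]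
      push_cast
      rw [add_assoc]
    · rw [matVec_parityPDA_succ]
      have h1 := parityProb_sum i
      simp only [parityRuntime, bitSteps, parityProb, Bool.not_not]
      refine le_of_eq ?_
      norm_cast
      push_cast
      calc _ = 1 + bitSteps i + ((parityProb i).1 + (parityProb i).2) * bitSteps i
            + (((parityProb i).1 ^ 2 + (parityProb i).2 ^ 2) * parityRuntime n β s
            + 2 * (parityProb i).1 * (parityProb i).2 * parityRuntime n β (!s)) := by ring
        _ = _ := by rw [h1]; ring
    · cases s with
      | false =>
        rw [matVec_parityPDA_test_false]
        simp only [parityRuntime]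
        push_cast
        rfl
      | true =>
        rw [matVec_parityPDA_test_true]
        simp only [parityRuntime]
        push_cast
        refine le_of_eq ?_
        ring
    · rw [matVec_parityPDA_generator]
      have h1 := parityProb_sum n
      have h2 := generatorSteps_eq n
      simp only [parityRuntime, Bool.not_false, Fin.val_last]
      refine le_of_eq ?_
      norm_cast
      push_cast
      calc _ = 1 + bitSteps n + ((parityProb n).1 + (parityProb n).2)
              * (1 + parityRuntime n β false)
            + 2 * (parityProb n).2 * generatorSteps n := by ring
        _ = bitSteps n + 2 + 2 * (parityProb n).2 * generatorSteps n
            + parityRuntime n β false := by rw [h1]; ring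
        _ = _ := by rw [← h2]

theorem parityPDA_isPAST (n : ℕ) : (parityPDA n).IsPAST :=
  fun c => (ertConfig_parityPDA_le n c).trans_lt ENNReal.coe_lt_top

/-! ### Lower bound on the runtime -/

/-- A nonnegative solution of the linear recurrence for the expected duration of a gambler's ruin
with drift `-(a - c)` is at least the inverse of the drift at one. -/
theorem one_le_mul_of_recurrence {r : ℕ → ℝ} {ℓ a c : ℝ} (h0 : r 0 = 0) (hr : ∀ k, 0 ≤ r k)
    (hrec : ∀ k, r (k + 1) = ℓ + a * r k + c * r (k + 2)) (hac : a + c = 1) (hc : 0 < c)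
    (hca : c ≤ a) (hℓ : 1 ≤ ℓ) : 1 ≤ (a - c) * r 1 := by
  by_contra! hlt
  set η : ℝ := ℓ - (a - c) * r 1 with hη
  have hη0 : 0 < η := by linarith
  -- If the claim failed, the increments of `r` would drop by at least `η` in each step, so `r`
  -- would lie below a concave parabola and become negative.
  have hdiff : ∀ k : ℕ, r (k + 1) - r k ≤ r 1 - k * η := by
    intro k
    induction k with
    | zero => simp [h0]
    | succ k ih =>
      have h1 : c * (r (k + 2) - r (k + 1)) = a * (r (k + 1) - r k) - ℓ := by
        linear_combination -hrec k - r (k + 1) * hac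
      have h2 : r (k + 1) - r k ≤ r 1 := ih.trans (by
        have : 0 ≤ (k : ℝ) * η := by positivity
        linarith)
      have h3 : (a - c) * (r (k + 1) - r k) ≤ (a - c) * r 1 :=
        mul_le_mul_of_nonneg_left h2 (by linarith)
      -- Uses `c ≤ 1`, so that subtracting `η` is at least as strong as subtracting `c * η`.
      have h4 : c * (r (k + 2) - r (k + 1)) ≤ c * (r (k + 1) - r k - η) := by
        nlinarith
      have h5 := le_of_mul_le_mul_left h4 hc
      push_cast
      linarith
  have hbound : ∀ k : ℕ, r k ≤ k * r 1 - k * (k - 1) / 2 * η := by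
    intro k
    induction k with
    | zero => simp [h0]
    | succ k ih =>
      have := hdiff k
      push_cast
      nlinarith
  -- This `m` makes `r 1 - m / 2 * η` negative, and with it the bound on `r (m + 1)`.
  obtain ⟨m, hm⟩ := exists_nat_gt (2 * r 1 / η)
  rw [div_lt_iff₀ hη0] at hm
  have h1 := hbound (m + 1)
  have h2 := hr (m + 1)
  push_cast at h1
  have h3 : ((m : ℝ) + 1) * (r 1 - m / 2 * η) < 0 :=
    mul_neg_of_pos_of_neg (by positivity) (by linarith)
  nlinarith

/-- The runtimes of stacks of `k` generators satisfy the gambler's ruin recurrence with round cost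
`bitSteps n + 2`. PAST makes them finite, so that the recurrence passes to the reals. -/
theorem two_pow_le_ert_parityPDA (n : ℕ) :
    (2 : ℝ≥0∞) ^ 2 ^ n ≤ (parityPDA n).ert false (.inr true) := by
  set e := (parityPDA n).ertConfig with he
  have hfin : ∀ c, e c ≠ ∞ := fun c => (parityPDA_isPAST n c).ne
  have hcons := (parityPDA n).ertConfig_cons
  let R : ℕ → ℝ≥0∞ := fun k => e (false, List.replicate k (.inr true))
  have hR : ∀ k, R (k + 1) = (bitSteps n + 2) + ((parityProb n).1 : ℝ≥0∞) * R k
      + ((parityProb n).2 : ℝ≥0∞) * R (k + 2) := by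
    intro k
    have h1 : ((parityProb n).1 : ℝ≥0∞) + (parityProb n).2 = 1 := by
      exact_mod_cast parityProb_sum n
    simp only [R, List.replicate_succ]
    rw [he, hcons, matVec_parityPDA_generator, eq_of_bit_cons _ _ hcons, Bool.not_false,
      hcons false (.inr false), hcons true (.inr false), matVec_parityPDA_test_false,
      matVec_parityPDA_test_true, Fin.val_last]
    set A := (parityPDA n).ertConfig (false, List.replicate k (.inr true))
    set B := (parityPDA n).ertConfig
      (false, .inr true :: .inr true :: List.replicate k (.inr true))
    calc _ = bitSteps n + 1 + (((parityProb n).1 : ℝ≥0∞) + (parityProb n).2)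
          + (((parityProb n).1 : ℝ≥0∞) * A + ((parityProb n).2 : ℝ≥0∞) * B) := by ring
      _ = _ := by rw [h1]; ring
  have hreal : ∀ k, (R (k + 1)).toReal = (bitSteps n + 2) + (parityProb n).1 * (R k).toReal
      + (parityProb n).2 * (R (k + 2)).toReal := by
    intro k
    have hk : R k ≠ ∞ := hfin _
    have hk' : R (k + 2) ≠ ∞ := hfin _
    rw [hR k]
    lift R k to ℝ≥0 using hk with x
    lift R (k + 2) to ℝ≥0 using hk' with y
    norm_cast
  have hb := parityProb_bias n
  have hpos : (0 : ℝ) < (1 / 2) ^ 2 ^ n := by positivity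
  have hc : (0 : ℝ) < (parityProb n).2 := by
    have := quarter_le_parityProb_snd n
    exact_mod_cast lt_of_lt_of_le (by norm_num) this
  have key := one_le_mul_of_recurrence (r := fun k => (R k).toReal)
    (by simp [R, he, WeightedPDA.ertConfig_nil]) (fun k => ENNReal.toReal_nonneg) hreal
    (parityProb_sum_real n) hc (by linarith) (by linarith [(bitSteps n).cast_nonneg (α := ℝ)])
  rw [hb, one_div, inv_pow, inv_mul_eq_div, one_le_div (by positivity)] at key
  have : (2 : ℝ≥0∞) ^ 2 ^ n = ENNReal.ofReal (2 ^ 2 ^ n) := by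
    rw [ENNReal.ofReal_pow (by norm_num)]
    simp
  rw [this]
  exact ENNReal.ofReal_le_of_le_toReal key

/-! ### Emptying the stack only in the state `false` -/

/-- The configurations in which the bottom of the stack is a generator or a test symbol, and the
configuration in which such a symbol has been popped. -/
def guardedConfigs (n : ℕ) : Set (Bool × List (ParitySymbol n)) :=
  {c | (∃ u b, c.2 = u ++ [.inr b]) ∨ c = (false, [])}

theorem singleton_mem_guardedConfigs {n : ℕ} (s b : Bool) :
    (s, [.inr b]) ∈ guardedConfigs n :=
  Or.inl ⟨[], b, rfl⟩

theorem mem_guardedConfigs_of_step {n : ℕ} {c d : Bool × List (ParitySymbol n)}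
    (hc : c ∈ guardedConfigs n) (h : (parityPDA n).step c d ≠ 0) : d ∈ guardedConfigs n := by
  classical
  obtain ⟨p, _ | ⟨Z, β⟩⟩ := c
  · simp [WeightedPDA.step] at h
  · obtain ⟨t, ht, hsrc, htop, rfl⟩ := WeightedPDA.exists_trans_of_step_ne_zero _ h
    obtain ⟨u, b, hu⟩ | hc := hc
    · obtain _ | ⟨Z', u⟩ := u
      · have hmem : t ∈ parityRules n p Z := by
          rw [← parityPDA_filter_trans]
          exact Finset.mem_filter.2 ⟨ht, hsrc, htop⟩
        simp only [List.nil_append, List.cons.injEq] at hu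
        obtain ⟨rfl, rfl⟩ := hu
        rcases b with _ | _ <;> rcases p with _ | _ <;>
          simp only [parityRules, Finset.mem_singleton] at hmem <;> subst hmem
        · exact Or.inr rfl
        · exact Or.inl ⟨[.inr true], true, rfl⟩
        · exact Or.inl ⟨[.inl (Fin.last n)], false, rfl⟩
        · exact Or.inl ⟨[.inl (Fin.last n)], false, rfl⟩
      · simp only [List.cons_append, List.cons.injEq] at hu
        exact Or.inl ⟨t.push ++ u, b, by simp [hu.2]⟩
    · simp at hc

/-- Within `guardedConfigs`, the only configuration with empty stack is `(false, [])`, so reaching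
it and emptying the stack are the same event. -/
theorem ert_eq_firstMoment_parityPDA (n : ℕ) (s b : Bool) :
    (parityPDA n).ert s (.inr b) = (parityPDA n).firstMoment s (.inr b) false := by
  refine expectedRuntime_eq_terminationMoment (G := guardedConfigs n) ?_
    (fun c hc _ d hd => mem_guardedConfigs_of_step hc hd) ?_ (singleton_mem_guardedConfigs s b)
    (parityPDA_isPAST n _).ne
  · rintro ⟨p, β⟩ (⟨u, b, hu⟩ | hc)
    · simp only at hu
      simp [WeightedPDA.emptyStack, hu]
    · simp [WeightedPDA.emptyStack, hc]
  · rintro ⟨p, _ | ⟨Z, β⟩⟩ - hc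
    · exact absurd rfl hc
    · exact WeightedPDA.tsum_step_cons _ (parityPDA_isProbabilistic n) p Z β

theorem returnProb_parityPDA_true (n : ℕ) (s b : Bool) :
    (parityPDA n).returnProb s (.inr b) true = 0 := by
  refine terminationMoment_eq_zero (G := guardedConfigs n) ?_
    (fun c hc d hd => mem_guardedConfigs_of_step hc hd) 0 (singleton_mem_guardedConfigs s b)
  rintro ⟨p, β⟩ (⟨u, b, hu⟩ | hc)
  · simp only at hu
    simp [hu]
  · simp [hc]

/-! ### Return probabilities -/

theorem quarter_le_minReturnProb_parityPDA (n : ℕ) :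
    ((1 / 4 : ℝ≥0) : ℝ≥0∞) ≤ (parityPDA n).minReturnProb := by
  refine le_sInf ?_
  rintro x ⟨hx, p, Z, q, rfl⟩
  set v : Bool × List (ParitySymbol n) → ℝ≥0∞ :=
    fun c => terminationMoment (parityPDA n).step 0 c {(q, [])} with hv
  have hcons : ∀ p Z β, v (p, Z :: β) = 0 + matVec (parityPDA n).step v (p, Z :: β) := by
    intro p Z β
    rw [zero_add]
    exact terminationMoment_zero_of_notMem (by simp)
  have hnil : v (q, []) = 1 := terminationMoment_zero_of_mem rfl
  change _ ≤ v (p, [Z])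
  rcases Z with i | b
  · rw [eq_of_bit_cons _ _ hcons]
    have h1 : ((1 / 4 : ℝ≥0) : ℝ≥0∞) ≤ (parityProb i).1 := by
      refine ENNReal.coe_le_coe.2 (le_trans ?_ (half_le_parityProb_fst i))
      rw [← NNReal.coe_le_coe]
      norm_num
    have h2 : ((1 / 4 : ℝ≥0) : ℝ≥0∞) ≤ (parityProb i).2 :=
      ENNReal.coe_le_coe.2 (quarter_le_parityProb_snd i)
    obtain rfl | hpq := eq_or_ne q p
    · rw [hnil, mul_one, mul_zero, zero_add]
      exact h1.trans le_self_add
    · rw [← Bool.eq_not_of_ne hpq, hnil, mul_one]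
      exact h2.trans le_add_self
  · cases q with
    | true => exact absurd (returnProb_parityPDA_true n p b) hx
    | false =>
      -- Only the branch of even parity is kept: the test symbol is then popped at once, and this
      -- has probability at least 1/2. From the state `true`, the test symbol leaves two generators,
      -- hence 1/4.
      have hgen : ∀ s β, ((1 / 2 : ℝ≥0) : ℝ≥0∞) * v (false, β) ≤ v (s, .inr true :: β) := by
        intro s β
        rw [hcons, matVec_parityPDA_generator, eq_of_bit_cons _ _ hcons,
          hcons false (.inr false), matVec_parityPDA_test_false, mul_zero, zero_add, zero_add,
          zero_add]
        refine le_trans ?_ le_self_add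
        gcongr
        exact half_le_parityProb_fst _
      have hhalf : ((1 / 4 : ℝ≥0) : ℝ≥0∞) = (1 / 2 : ℝ≥0) * (1 / 2 : ℝ≥0) := by
        rw [← ENNReal.coe_mul]
        congr 1
        rw [← NNReal.coe_inj]
        norm_num
      have hhalf' : ((1 / 2 : ℝ≥0) : ℝ≥0∞) ≤ 1 := by
        rw [← ENNReal.coe_one, ENNReal.coe_le_coe, ← NNReal.coe_le_coe]
        norm_num
      have hgen1 : ∀ s, ((1 / 2 : ℝ≥0) : ℝ≥0∞) ≤ v (s, [.inr true]) := by
        intro s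
        simpa [hnil] using hgen s []
      rw [hhalf]
      rcases b with _ | _
      · rcases p with _ | _
        · rw [hcons, matVec_parityPDA_test_false, hnil, zero_add]
          exact mul_le_one' hhalf' hhalf'
        · rw [hcons, matVec_parityPDA_test_true, zero_add]
          exact (mul_le_mul_right (hgen1 false) _).trans (hgen false _)
      · exact (mul_le_of_le_one_left' hhalf').trans (hgen1 p)

theorem theorem10 :
    ∃ (Q Γ : ℕ → Type) (_ : ∀ n, Fintype (Q n)) (_ : ∀ n, Fintype (Γ n))
      (Δ : ∀ n, WeightedPDA (Q n) (Γ n)) (p : ∀ n, Q n) (Y : ∀ n, Γ n),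
      (∀ n, 1 ≤ n →
        (Δ n).IsProbabilistic ∧
        (Δ n).IsPAST ∧
        (Δ n).ert (p n) (Y n) = (Δ n).firstMoment (p n) (Y n) (p n) ∧
        (2 : ℝ≥0∞) ^ (2 ^ n) ≤ (Δ n).ert (p n) (Y n)) ∧
      (∃ c : ℝ≥0, 0 < c ∧ ∀ n, 1 ≤ n → (c : ℝ≥0∞) ≤ (Δ n).minReturnProb) ∧
      (∃ C : ℕ, ∀ n, 1 ≤ n →
        n ≤ C * (Δ n).encodingSize ∧ (Δ n).encodingSize ≤ C * n) := by
  refine ⟨fun _ => Bool, ParitySymbol, fun _ => inferInstance, fun _ => inferInstance, parityPDA,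
    fun _ => false, fun _ => .inr true, fun n _ => ?_, ⟨1 / 4, by simp, fun n _ => ?_⟩,
    -- `126 = 31 + 95` absorbs the constant term of the size bound for `n ≥ 1`.
    ⟨126, fun n hn => ?_⟩⟩
  · exact ⟨parityPDA_isProbabilistic n, parityPDA_isPAST n,
      ert_eq_firstMoment_parityPDA n false true, two_pow_le_ert_parityPDA n⟩
  · exact quarter_le_minReturnProb_parityPDA n
  · have := encodingSize_parityPDA n
    constructor <;> linarith
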